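/- Let $n \in \{2,3\}$, let $\Omega \subset \mathbb{R}^n$ be a bounded open set, and let $\Gamma \subset \Omega$ be a $C^2$-hypersurface (possibly with boundary, possibly with several connected components) for which there is an open set $U \subset \Omega$ with Lipschitz boundary such that $\Gamma \subset \partial U$. Let $H_0^1(\Omega)$ be the closure of $C_c^\infty(\Omega)$ in $H^1(\Omega)$, with the norm $\|y\|_{H_0^1(\Omega)} = \big(\|y\|_{L^2(\Omega)}^2 + \|\nabla y\|_{L^2(\Omega)}^2\big)^{1/2}$, and let $L^2(\Gamma)$ be formed with respect to the surface measure on $\Gamma$, i.e. the $(n-1)$-dimensional Hausdorff measure. Then there exists a continuous linear operator $T : H_0^1(\Omega) \to L^2(\Gamma)$ such that $$Ty = y|_\Gamma \qquad \text{for all } y \in H_0^1(\Omega) \cap C(\Omega).$$ In particular, there is a constant $C > 0$, independent of $y$, such that $$\|Ty\|_{L^2(\Gamma)} \le C\, \|y\|_{H_0^1(\Omega)} \qquad \text{for all } y \in H_0^1(\Omega).$$ -/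

import Mathlib

open MeasureTheory TopologicalSpace
open scoped Distributions

/-- `Γ ⊆ ℝⁿ` is a `C²`-hypersurface, possibly with boundary. Near each of its points, `Γ` is
`{φ = 0, ψ ≤ 0}` with `φ`, `ψ` of class `C²`, where `∇φ ≠ 0` on `Γ` and `∇φ`, `∇ψ` are linearly
independent at the points of `Γ` with `ψ = 0` (the boundary points). The choice `ψ = -1` gives the
usual condition at an interior point: near it, `Γ` is the zero set of a `C²` function `φ` with
`∇φ ≠ 0` on `Γ`. Neither closedness nor connectedness is required. -/
def IsC2Hypersurface {n : ℕ} (Γ : Set (EuclideanSpace ℝ (Fin n))) : Prop :=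
  ∀ p ∈ Γ, ∃ (W : Set (EuclideanSpace ℝ (Fin n))) (φ ψ : EuclideanSpace ℝ (Fin n) → ℝ),
    IsOpen W ∧ p ∈ W ∧ ContDiffOn ℝ 2 φ W ∧ ContDiffOn ℝ 2 ψ W ∧
    W ∩ Γ = {x ∈ W | φ x = 0 ∧ ψ x ≤ 0} ∧
    (∀ x ∈ W ∩ Γ, fderiv ℝ φ x ≠ 0) ∧
    ∀ x ∈ W ∩ Γ, ψ x = 0 → LinearIndependent ℝ ![fderiv ℝ φ x, fderiv ℝ ψ x]

/-- The open set `U ⊆ ℝⁿ` has a Lipschitz boundary: around each `p ∈ ∂U` there are orthogonal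
coordinates `x = p + y + t ν` (with `ν` a unit vector, `y ⊥ ν` and `t ∈ ℝ`), a cylinder
`{‖y‖ < r, |t| < h}` and a Lipschitz function `φ` with `|φ| ≤ h / 2` for `‖y‖ < r`, such that in
the cylinder `U` is the set `t < φ y` below the graph of `φ` and `∂U` is that graph. -/
def HasLipschitzBoundary {n : ℕ} (U : Set (EuclideanSpace ℝ (Fin n))) : Prop :=
  ∀ p ∈ frontier U, ∃ ν : EuclideanSpace ℝ (Fin n), ‖ν‖ = 1 ∧
    ∃ (r h : ℝ) (K : NNReal) (φ : (ℝ ∙ ν)ᗮ → ℝ), 0 < r ∧ 0 < h ∧ LipschitzWith K φ ∧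
      ∀ y : (ℝ ∙ ν)ᗮ, ‖y‖ < r → |φ y| ≤ h / 2 ∧
        ∀ t : ℝ, |t| < h →
          (p + (y : EuclideanSpace ℝ (Fin n)) + t • ν ∈ U ↔ t < φ y) ∧
          (p + (y : EuclideanSpace ℝ (Fin n)) + t • ν ∈ frontier U ↔ t = φ y)

/-- `g` is the weak gradient of `u` on the open set `Ω`, tested against `C_c^∞(Ω)`. -/
def IsWeakGradient {n : ℕ} (Ω : Opens (EuclideanSpace ℝ (Fin n)))
    (u : EuclideanSpace ℝ (Fin n) → ℝ)
    (g : EuclideanSpace ℝ (Fin n) → EuclideanSpace ℝ (Fin n)) : Prop :=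
  ∀ (φ : 𝓓(Ω, ℝ)) (v : EuclideanSpace ℝ (Fin n)),
    ∫ x in (Ω : Set (EuclideanSpace ℝ (Fin n))), u x * fderiv ℝ φ x v =
      -∫ x in (Ω : Set (EuclideanSpace ℝ (Fin n))), inner ℝ (g x) v * φ x

/-- `L²(Ω)`. -/
abbrev L2Dom {n : ℕ} (Ω : Opens (EuclideanSpace ℝ (Fin n))) : Type :=
  Lp ℝ 2 (volume.restrict (Ω : Set (EuclideanSpace ℝ (Fin n))))

/-- `L²(Ω; ℝⁿ)`. -/
abbrev L2VecDom {n : ℕ} (Ω : Opens (EuclideanSpace ℝ (Fin n))) : Type :=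
  Lp (EuclideanSpace ℝ (Fin n)) 2 (volume.restrict (Ω : Set (EuclideanSpace ℝ (Fin n))))

theorem integrable_mul_fderiv_testFunction {n : ℕ} {Ω : Opens (EuclideanSpace ℝ (Fin n))}
    (u : L2Dom Ω) (φ : 𝓓(Ω, ℝ)) (v : EuclideanSpace ℝ (Fin n)) :
    Integrable (fun x => u x * fderiv ℝ φ x v)
      (volume.restrict (Ω : Set (EuclideanSpace ℝ (Fin n)))) := by
  have hc : Continuous (fun x => fderiv ℝ φ x v) :=
    (φ.contDiff.continuous_fderiv (by simp)).clm_apply continuous_const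
  have hs : HasCompactSupport (fun x => fderiv ℝ φ x v) :=
    φ.hasCompactSupport.fderiv_apply (𝕜 := ℝ) v
  exact (Lp.memLp u).integrable_mul
    ((hc.memLp_of_hasCompactSupport (p := 2) (μ := volume) hs).restrict _)

theorem integrable_inner_mul_testFunction {n : ℕ} {Ω : Opens (EuclideanSpace ℝ (Fin n))}
    (g : L2VecDom Ω) (φ : 𝓓(Ω, ℝ)) (v : EuclideanSpace ℝ (Fin n)) :
    Integrable (fun x => inner ℝ (g x) v * φ x)
      (volume.restrict (Ω : Set (EuclideanSpace ℝ (Fin n)))) := by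
  have h := (φ.continuous.memLp_of_hasCompactSupport (p := 2) (μ := volume)
    φ.hasCompactSupport).restrict (Ω : Set (EuclideanSpace ℝ (Fin n)))
  exact ((Lp.memLp g).inner_const v).integrable_mul h

/-- The Sobolev space `H¹(Ω)`: the pairs `(u, ∇u)` in `L²(Ω) × L²(Ω; ℝⁿ)`, where `∇u` is the weak
gradient of `u`. Its norm is `(‖u‖² + ‖∇u‖²)^{1/2}` with the norms of `L²`. -/
def H1 {n : ℕ} (Ω : Opens (EuclideanSpace ℝ (Fin n))) :
    Submodule ℝ (WithLp 2 (L2Dom Ω × L2VecDom Ω)) where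
  carrier := {y | IsWeakGradient Ω y.fst y.snd}
  add_mem' := by
    intro a b ha hb φ v
    have h1 := ha φ v
    have h2 := hb φ v
    rw [WithLp.add_fst, WithLp.add_snd]
    have e1 : ∀ᵐ x ∂(volume.restrict (Ω : Set (EuclideanSpace ℝ (Fin n)))),
        (a.fst + b.fst : L2Dom Ω) x * fderiv ℝ φ x v =
          a.fst x * fderiv ℝ φ x v + b.fst x * fderiv ℝ φ x v := by
      filter_upwards [Lp.coeFn_add a.fst b.fst] with x hx
      rw [hx, Pi.add_apply, add_mul]
    have e2 : ∀ᵐ x ∂(volume.restrict (Ω : Set (EuclideanSpace ℝ (Fin n)))),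
        inner ℝ ((a.snd + b.snd : L2VecDom Ω) x) v * φ x =
          inner ℝ (a.snd x) v * φ x + inner ℝ (b.snd x) v * φ x := by
      filter_upwards [Lp.coeFn_add a.snd b.snd] with x hx
      rw [hx, Pi.add_apply, inner_add_left, add_mul]
    rw [integral_congr_ae e1, integral_congr_ae e2,
      integral_add (integrable_mul_fderiv_testFunction _ _ _)
        (integrable_mul_fderiv_testFunction _ _ _),
      integral_add (integrable_inner_mul_testFunction _ _ _)
        (integrable_inner_mul_testFunction _ _ _), h1, h2, neg_add]
  zero_mem' := by
    intro φ v
    have e1 : ∀ᵐ x ∂(volume.restrict (Ω : Set (EuclideanSpace ℝ (Fin n)))),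
        (0 : L2Dom Ω) x * fderiv ℝ φ x v = 0 := by
      filter_upwards [Lp.coeFn_zero ℝ 2
        (volume.restrict (Ω : Set (EuclideanSpace ℝ (Fin n))))] with x hx
      rw [hx, Pi.zero_apply, zero_mul]
    have e2 : ∀ᵐ x ∂(volume.restrict (Ω : Set (EuclideanSpace ℝ (Fin n)))),
        inner ℝ ((0 : L2VecDom Ω) x) v * φ x = 0 := by
      filter_upwards [Lp.coeFn_zero (EuclideanSpace ℝ (Fin n)) 2
        (volume.restrict (Ω : Set (EuclideanSpace ℝ (Fin n))))] with x hx
      rw [hx, Pi.zero_apply, inner_zero_left, zero_mul]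
    rw [WithLp.zero_fst, WithLp.zero_snd, integral_congr_ae e1, integral_congr_ae e2]
    simp
  smul_mem' := by
    intro c a ha φ v
    have h1 := ha φ v
    rw [WithLp.smul_fst, WithLp.smul_snd]
    have e1 : ∀ᵐ x ∂(volume.restrict (Ω : Set (EuclideanSpace ℝ (Fin n)))),
        (c • a.fst : L2Dom Ω) x * fderiv ℝ φ x v = c * (a.fst x * fderiv ℝ φ x v) := by
      filter_upwards [Lp.coeFn_smul c a.fst] with x hx
      rw [hx, Pi.smul_apply, smul_eq_mul, mul_assoc]
    have e2 : ∀ᵐ x ∂(volume.restrict (Ω : Set (EuclideanSpace ℝ (Fin n)))),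
        inner ℝ ((c • a.snd : L2VecDom Ω) x) v * φ x = c * (inner ℝ (a.snd x) v * φ x) := by
      filter_upwards [Lp.coeFn_smul c a.snd] with x hx
      rw [hx, Pi.smul_apply, real_inner_smul_left, mul_assoc]
    rw [integral_congr_ae e1, integral_congr_ae e2, integral_const_mul, integral_const_mul, h1,
      mul_neg]

/-- `C_c^∞(Ω)` as a subspace of `H¹(Ω)`: the pairs `(φ, ∇φ)`, `φ ∈ C_c^∞(Ω)`. -/
def testSubspace {n : ℕ} (Ω : Opens (EuclideanSpace ℝ (Fin n))) : Submodule ℝ (H1 Ω) where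
  carrier := {y | ∃ φ : 𝓓(Ω, ℝ),
    (y.1.fst : EuclideanSpace ℝ (Fin n) → ℝ)
      =ᵐ[volume.restrict (Ω : Set (EuclideanSpace ℝ (Fin n)))] φ ∧
    (y.1.snd : EuclideanSpace ℝ (Fin n) → EuclideanSpace ℝ (Fin n))
      =ᵐ[volume.restrict (Ω : Set (EuclideanSpace ℝ (Fin n)))] gradient φ}
  add_mem' := by
    rintro a b ⟨φ, h1, h2⟩ ⟨ψ, h3, h4⟩
    refine ⟨φ + ψ, ?_, ?_⟩
    · rw [Submodule.coe_add, WithLp.add_fst]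
      filter_upwards [Lp.coeFn_add a.1.fst b.1.fst, h1, h3] with x hx hx1 hx3
      rw [hx, Pi.add_apply, hx1, hx3]
      rfl
    · rw [Submodule.coe_add, WithLp.add_snd]
      filter_upwards [Lp.coeFn_add a.1.snd b.1.snd, h2, h4] with x hx hx1 hx3
      have hφ := φ.contDiff.differentiable (by simp) x
      have hψ := ψ.contDiff.differentiable (by simp) x
      have e : ((φ + ψ : 𝓓(Ω, ℝ)) : EuclideanSpace ℝ (Fin n) → ℝ) = ⇑φ + ⇑ψ := rfl
      rw [hx, Pi.add_apply, hx1, hx3, e]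
      simp only [gradient]
      rw [fderiv_add hφ hψ, map_add]
  zero_mem' := by
    refine ⟨0, ?_, ?_⟩
    · rw [Submodule.coe_zero, WithLp.zero_fst]
      exact Lp.coeFn_zero ℝ 2 _
    · rw [Submodule.coe_zero, WithLp.zero_snd]
      filter_upwards [Lp.coeFn_zero (EuclideanSpace ℝ (Fin n)) 2
        (volume.restrict (Ω : Set (EuclideanSpace ℝ (Fin n))))] with x hx
      have e : ((0 : 𝓓(Ω, ℝ)) : EuclideanSpace ℝ (Fin n) → ℝ) = fun _ => 0 := rfl
      rw [hx, e]
      simp [gradient]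
  smul_mem' := by
    rintro c a ⟨φ, h1, h2⟩
    refine ⟨c • φ, ?_, ?_⟩
    · rw [Submodule.coe_smul, WithLp.smul_fst]
      filter_upwards [Lp.coeFn_smul c a.1.fst, h1] with x hx hx1
      rw [hx, Pi.smul_apply, hx1]
      rfl
    · rw [Submodule.coe_smul, WithLp.smul_snd]
      filter_upwards [Lp.coeFn_smul c a.1.snd, h2] with x hx hx1
      have hφ := φ.contDiff.differentiable (by simp) x
      have e : ((c • φ : 𝓓(Ω, ℝ)) : EuclideanSpace ℝ (Fin n) → ℝ) = c • ⇑φ := rfl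
      rw [hx, Pi.smul_apply, hx1, e]
      simp only [gradient]
      rw [fderiv_const_smul hφ]
      simp

/-- `H_0^1(Ω)`: the closure of `C_c^∞(Ω)` in `H¹(Ω)`, with the norm of `H¹(Ω)`. -/
noncomputable def H01 {n : ℕ} (Ω : Opens (EuclideanSpace ℝ (Fin n))) : Submodule ℝ (H1 Ω) :=
  (testSubspace Ω).topologicalClosure

/-- The function (class) in `L²(Ω)` underlying an element of `H_0^1(Ω)`. -/
noncomputable def H01.toL2 {n : ℕ} {Ω : Opens (EuclideanSpace ℝ (Fin n))} (y : H01 Ω) : L2Dom Ω :=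
  y.1.1.fst

/-- The surface measure on `Γ ⊆ ℝⁿ`: the `(n - 1)`-dimensional Hausdorff measure on `Γ`. -/
noncomputable def surfaceMeasure {n : ℕ} (Γ : Set (EuclideanSpace ℝ (Fin n))) :
    Measure (EuclideanSpace ℝ (Fin n)) :=
  (Measure.euclideanHausdorffMeasure (n - 1)).restrict Γ

/-- `L²(Γ)` with respect to the surface measure. -/
abbrev L2Surf {n : ℕ} (Γ : Set (EuclideanSpace ℝ (Fin n))) : Type :=
  Lp ℝ 2 (surfaceMeasure Γ)

/-! ### Elementary inequalities for squares -/

open Filter Topology ENNReal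

/-! Call a measure μ transverse to a unit vector ν if ∫∫ g(x + tν) dt dμ(x) ≤ C ∫ g for all
measurable g ≥ 0. Surface measure on a Lipschitz graph over νᗮ has this property, by Fubini in the
coordinates (y, t). The boundary of a bounded Lipschitz set is compact, so finitely many transverse
pieces cover Γ (`HasLipschitzBoundary.exists_finite_isTransverse`).

For a test function f, extended by zero to ℝⁿ, compare f(x) with f(x + tν), 0 < t ≤ 1. The
fundamental theorem of calculus and Cauchy–Schwarz bound the difference by ∇f on the line x + ℝν,
and transversality turns integrals over lines into integrals over ℝⁿ
(`IsTransverse.lintegral_sq_le`). So restriction of test functions is bounded in the H¹ norm and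
extends to H₀¹ by density.

If y has a continuous representative v, the extension must still be v on Γ, although the
approximating test functions need not converge to v uniformly. For t ≤ δ the comparison gives a
bound of order δ² that survives the limit of test functions. Dividing by δ and letting δ → 0,
Fatou's lemma gives Ty = v on each piece (`IsTransverse.ae_eq_of_tendsto`). -/

theorem ENNReal.add_sq_le_two_mul (a b : ℝ≥0∞) : (a + b) ^ 2 ≤ 2 * (a ^ 2 + b ^ 2) := by
  have h := ENNReal.rpow_add_le_mul_rpow_add_rpow a b (p := 2) (by norm_num)
  have e : (2 : ℝ) - 1 = 1 := by norm_num
  rw [e] at h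
  exact_mod_cast h

theorem MeasureTheory.lintegral_sq_le {α : Type*} [MeasurableSpace α] {μ : Measure α}
    {f : α → ℝ≥0∞} (hf : AEMeasurable f μ) :
    (∫⁻ x, f x ∂μ) ^ 2 ≤ μ Set.univ * ∫⁻ x, f x ^ 2 ∂μ := by
  have h := ENNReal.lintegral_mul_le_Lp_mul_Lq μ Real.HolderConjugate.two_two hf
    (aemeasurable_const (b := (1 : ℝ≥0∞)))
  simp only [Pi.mul_apply, mul_one, ENNReal.one_rpow, lintegral_const, one_mul] at h
  have h2 := pow_le_pow_left' h 2
  rw [mul_pow] at h2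
  have e : ∀ a : ℝ≥0∞, (a ^ (1 / 2 : ℝ)) ^ 2 = a := by
    intro a
    rw [← ENNReal.rpow_natCast, ← ENNReal.rpow_mul]
    norm_num
  rw [e, e] at h2
  rw [mul_comm]
  exact_mod_cast h2

/-! ### Transverse measures: trace inequality and identification of limits -/

section

variable {E : Type*} [NormedAddCommGroup E] [NormedSpace ℝ E]

/-- The increment of a `C¹` function along a segment, by the fundamental theorem of calculus and
the Cauchy-Schwarz inequality. -/
theorem enorm_sub_sq_le_lintegral_fderiv {f : E → ℝ} (hf : ContDiff ℝ 1 f) {ν : E} (hν : ‖ν‖ = 1)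
    (x : E) {t δ : ℝ} (ht : t ∈ Set.Ioc 0 δ) :
    ‖f x - f (x + t • ν)‖ₑ ^ 2 ≤
      ENNReal.ofReal δ * ∫⁻ s : ℝ, ‖fderiv ℝ f (x + s • ν)‖ₑ ^ 2 := by
  have hc : Continuous fun s : ℝ => fderiv ℝ f (x + s • ν) :=
    (hf.continuous_fderiv one_ne_zero).comp (by fun_prop)
  have hd : ∀ s ∈ Set.uIcc 0 t,
      HasDerivAt (fun s : ℝ => f (x + s • ν)) (fderiv ℝ f (x + s • ν) ν) s := by
    intro s _
    have h1 : HasDerivAt (fun s : ℝ => x + s • ν) ν s := by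
      simpa using ((hasDerivAt_id s).smul_const ν).const_add x
    exact ((hf.differentiable one_ne_zero _).hasFDerivAt).comp_hasDerivAt s h1
  have hint := intervalIntegral.integral_eq_sub_of_hasDerivAt hd
    ((hc.clm_apply continuous_const).intervalIntegrable _ _)
  simp only [zero_smul, add_zero] at hint
  rw [← neg_sub, ← hint, enorm_neg, intervalIntegral.integral_of_le ht.1.le]
  have h1 : ‖∫ s in Set.Ioc 0 t, fderiv ℝ f (x + s • ν) ν‖ₑ ≤
      ∫⁻ s in Set.Ioc 0 t, ‖fderiv ℝ f (x + s • ν)‖ₑ := by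
    refine (enorm_integral_le_lintegral_enorm _).trans (lintegral_mono fun s => ?_)
    have h2 := (fderiv ℝ f (x + s • ν)).le_opNorm ν
    rw [hν, mul_one] at h2
    exact enorm_le_iff_norm_le.mpr h2
  calc _ ≤ (∫⁻ s in Set.Ioc 0 t, ‖fderiv ℝ f (x + s • ν)‖ₑ) ^ 2 := pow_le_pow_left' h1 2
    _ ≤ _ := lintegral_sq_le hc.enorm.measurable.aemeasurable
    -- Enlarging the domain to the whole line removes t from the bound and gives the integral that
    -- transversality controls.
    _ ≤ _ := by
      rw [Measure.restrict_apply_univ, Real.volume_Ioc, sub_zero]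
      exact mul_le_mul' (ENNReal.ofReal_le_ofReal ht.2) (setLIntegral_le_lintegral _ _)

variable [MeasurableSpace E]

/-- `μ` is transverse to `ν`, with constant `C` and with respect to `m`: sweeping out `μ` in the
direction `ν` yields at most `C • m`. -/
def IsTransverse (m μ : Measure E) (ν : E) (C : ℝ≥0∞) : Prop :=
  ∀ g : E → ℝ≥0∞, Measurable g → ∫⁻ x, (∫⁻ t : ℝ, g (x + t • ν)) ∂μ ≤ C * ∫⁻ x, g x ∂m

theorem IsTransverse.mono {m μ μ' : Measure E} {ν : E} {C : ℝ≥0∞} (h : IsTransverse m μ ν C)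
    (hμ : μ' ≤ μ) : IsTransverse m μ' ν C :=
  fun g hg => (lintegral_mono' hμ le_rfl).trans (h g hg)

section

variable [BorelSpace E] {m μ : Measure E} {ν : E} {C : ℝ≥0∞}

/-- Integrating the segment bound over t ∈ (0, δ] yields a second factor δ. The power δ² matters:
mean increments over (0, δ] are then O(δ). -/
theorem IsTransverse.lintegral_sub_sq_le (h : IsTransverse m μ ν C)
    (hν : ‖ν‖ = 1) {f : E → ℝ} (hf : ContDiff ℝ 1 f) (δ : ℝ) :
    ∫⁻ x, (∫⁻ t in Set.Ioc 0 δ, ‖f x - f (x + t • ν)‖ₑ ^ 2) ∂μ ≤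
      ENNReal.ofReal δ ^ 2 * (C * ∫⁻ x, ‖fderiv ℝ f x‖ₑ ^ 2 ∂m) := by
  have hm : Measurable fun x => ‖fderiv ℝ f x‖ₑ ^ 2 :=
    ((hf.continuous_fderiv one_ne_zero).enorm.measurable).pow_const 2
  calc _ ≤ ∫⁻ x, ENNReal.ofReal δ ^ 2 * (∫⁻ s : ℝ, ‖fderiv ℝ f (x + s • ν)‖ₑ ^ 2) ∂μ := by
        refine lintegral_mono fun x => ?_
        calc _ ≤ ∫⁻ _ in Set.Ioc 0 δ,
              ENNReal.ofReal δ * ∫⁻ s : ℝ, ‖fderiv ℝ f (x + s • ν)‖ₑ ^ 2 :=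
              setLIntegral_mono' measurableSet_Ioc fun t ht =>
                enorm_sub_sq_le_lintegral_fderiv hf hν x ht
          _ = _ := by
            rw [setLIntegral_const, Real.volume_Ioc, sub_zero]
            ring
    _ = ENNReal.ofReal δ ^ 2 * ∫⁻ x, (∫⁻ s : ℝ, ‖fderiv ℝ f (x + s • ν)‖ₑ ^ 2) ∂μ :=
        lintegral_const_mul' _ _ (by finiteness)
    _ ≤ _ := mul_le_mul_right (h _ hm) _

/-- The trace inequality on a transverse measure. -/
theorem IsTransverse.lintegral_sq_le (h : IsTransverse m μ ν C) (hν : ‖ν‖ = 1) {f : E → ℝ}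
    (hf : ContDiff ℝ 1 f) [SecondCountableTopology E] :
    ∫⁻ x, ‖f x‖ₑ ^ 2 ∂μ ≤
      2 * C * (∫⁻ x, ‖f x‖ₑ ^ 2 ∂m + ∫⁻ x, ‖fderiv ℝ f x‖ₑ ^ 2 ∂m) := by
  have hm : Measurable fun x => ‖f x‖ₑ ^ 2 := (hf.continuous.enorm.measurable).pow_const 2
  have hp : ∀ x, ‖f x‖ₑ ^ 2 ≤ 2 * ((∫⁻ t : ℝ, ‖f (x + t • ν)‖ₑ ^ 2) +
      ∫⁻ t in Set.Ioc (0 : ℝ) 1, ‖f x - f (x + t • ν)‖ₑ ^ 2) := by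
    intro x
    have hc1 : Continuous fun t : ℝ => f (x + t • ν) := hf.continuous.comp (by fun_prop)
    calc ‖f x‖ₑ ^ 2 = ∫⁻ t in Set.Ioc (0 : ℝ) 1, ‖f x‖ₑ ^ 2 := by simp
      _ ≤ ∫⁻ t in Set.Ioc (0 : ℝ) 1,
          2 * (‖f (x + t • ν)‖ₑ ^ 2 + ‖f x - f (x + t • ν)‖ₑ ^ 2) := by
          refine lintegral_mono fun t => le_trans ?_ (ENNReal.add_sq_le_two_mul _ _)
          refine pow_le_pow_left' ?_ 2
          have h1 : f x = f (x + t • ν) + (f x - f (x + t • ν)) := by ring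
          conv_lhs => rw [h1]
          exact enorm_add_le _ _
      _ = 2 * ((∫⁻ t in Set.Ioc (0 : ℝ) 1, ‖f (x + t • ν)‖ₑ ^ 2) +
          ∫⁻ t in Set.Ioc (0 : ℝ) 1, ‖f x - f (x + t • ν)‖ₑ ^ 2) := by
          rw [lintegral_const_mul' _ _ (by finiteness), lintegral_add_left]
          exact hc1.enorm.measurable.pow_const 2
      -- Only the first term is enlarged to all t; the increments are controlled only for bounded t.
      _ ≤ _ := by gcongr; exact Measure.restrict_le_self
  have hm' : Measurable fun x => ∫⁻ t : ℝ, ‖f (x + t • ν)‖ₑ ^ 2 := by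
    have h1 : Measurable fun p : E × ℝ => p.1 + p.2 • ν := by fun_prop
    exact (hm.comp h1).lintegral_prod_right'
  calc _ ≤ _ := lintegral_mono hp
    _ = 2 * ((∫⁻ x, (∫⁻ t : ℝ, ‖f (x + t • ν)‖ₑ ^ 2) ∂μ) +
      ∫⁻ x, (∫⁻ t in Set.Ioc (0 : ℝ) 1, ‖f x - f (x + t • ν)‖ₑ ^ 2) ∂μ) := by
        rw [lintegral_const_mul' _ _ (by finiteness), lintegral_add_left hm']
    _ ≤ 2 * (C * ∫⁻ x, ‖f x‖ₑ ^ 2 ∂m +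
      ENNReal.ofReal 1 ^ 2 * (C * ∫⁻ x, ‖fderiv ℝ f x‖ₑ ^ 2 ∂m)) := by
        gcongr
        · exact h _ hm
        · exact h.lintegral_sub_sq_le hν hf 1
    _ = _ := by rw [ENNReal.ofReal_one, one_pow, one_mul]; ring

/-- Applied with a = τ x, b = f k x, c = f k (x + tν), d = w (x + tν): the terms are controlled by
convergence in L²(μ), the gradient bound and convergence in L²(m), respectively. -/
theorem enorm_sub_sq_le_three (a b c d : ℝ) :
    ‖a - d‖ₑ ^ 2 ≤ 4 * ‖b - a‖ₑ ^ 2 + 4 * ‖b - c‖ₑ ^ 2 + 2 * ‖c - d‖ₑ ^ 2 := by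
  have h1 : a - d = -((b - a) - (b - c)) + (c - d) := by ring
  calc ‖a - d‖ₑ ^ 2 ≤ (‖(b - a) - (b - c)‖ₑ + ‖c - d‖ₑ) ^ 2 := by
        rw [h1]
        refine pow_le_pow_left' ((enorm_add_le _ _).trans ?_) 2
        rw [enorm_neg]
    _ ≤ 2 * (‖(b - a) - (b - c)‖ₑ ^ 2 + ‖c - d‖ₑ ^ 2) := ENNReal.add_sq_le_two_mul _ _
    _ ≤ 2 * (2 * (‖b - a‖ₑ ^ 2 + ‖b - c‖ₑ ^ 2) + ‖c - d‖ₑ ^ 2) := by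
        gcongr
        exact (pow_le_pow_left' enorm_sub_le 2).trans (ENNReal.add_sq_le_two_mul _ _)
    _ = _ := by ring

/-- The averages of a function over shrinking intervals `(0, δ]` are asymptotically at least its
value at `0`, if it is continuous there. -/
theorem le_liminf_average_of_continuousAt {g : ℝ → ℝ≥0∞} (hg : ContinuousAt g 0) :
    g 0 ≤ liminf (fun j : ℕ => ((j : ℝ≥0∞) + 1) *
      ∫⁻ t in Set.Ioc (0 : ℝ) (1 / ((j : ℝ) + 1)), g t) atTop := by
  refine le_of_forall_lt fun c hc => ?_
  obtain ⟨c', hcc', hc'⟩ := exists_between hc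
  refine hcc'.trans_le (le_liminf_of_le (by isBoundedDefault) ?_)
  have h1 : ∀ᶠ t in 𝓝 (0 : ℝ), c' < g t := hg.eventually (lt_mem_nhds hc')
  obtain ⟨ε, hε, hball⟩ := Metric.eventually_nhds_iff.mp h1
  have h2 : ∀ᶠ j : ℕ in atTop, 1 / ((j : ℝ) + 1) < ε :=
    tendsto_one_div_add_atTop_nhds_zero_nat.eventually (gt_mem_nhds hε)
  filter_upwards [h2] with j hj
  have h3 : c' * volume (Set.Ioc (0 : ℝ) (1 / ((j : ℝ) + 1))) ≤
      ∫⁻ t in Set.Ioc (0 : ℝ) (1 / ((j : ℝ) + 1)), g t := by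
    rw [← setLIntegral_const]
    refine setLIntegral_mono' measurableSet_Ioc fun t ht => (hball ?_).le
    rw [Real.dist_eq, sub_zero, abs_of_pos ht.1]
    exact ht.2.trans_lt hj
  refine le_trans (le_of_eq ?_) (mul_le_mul_right h3 _)
  rw [Real.volume_Ioc, sub_zero, one_div, ENNReal.ofReal_inv_of_pos (by positivity),
    ENNReal.ofReal_add (by positivity) zero_le_one, ENNReal.ofReal_natCast, ENNReal.ofReal_one,
    mul_left_comm, ENNReal.mul_inv_cancel (by simp) (by finiteness), mul_one]

/-- If `C¹` functions with gradients bounded in `L²` converge in `L²` to `w`, and their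
restrictions converge in `L²(μ)` to `τ`, then `τ = w` wherever `w` is continuous. -/
theorem IsTransverse.ae_eq_of_tendsto [SecondCountableTopology E] (h : IsTransverse m μ ν C)
    (hν : ‖ν‖ = 1) (hC : C ≠ ∞) {f : ℕ → E → ℝ} (hf : ∀ k, ContDiff ℝ 1 (f k)) {w τ : E → ℝ}
    (hw : Measurable w) (hτ : Measurable τ) {M : ℝ≥0∞} (hM : M ≠ ∞)
    (hgrad : ∀ k, ∫⁻ x, ‖fderiv ℝ (f k) x‖ₑ ^ 2 ∂m ≤ M)
    (hfw : Tendsto (fun k => ∫⁻ x, ‖f k x - w x‖ₑ ^ 2 ∂m) atTop (𝓝 0))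
    (hfτ : Tendsto (fun k => ∫⁻ x, ‖f k x - τ x‖ₑ ^ 2 ∂μ) atTop (𝓝 0))
    (hcont : ∀ᵐ x ∂μ, ContinuousAt w x) : τ =ᵐ[μ] w := by
  have hshift : Measurable fun p : E × ℝ => p.1 + p.2 • ν := by fun_prop
  have hslice : ∀ x : E, Measurable fun t : ℝ => x + t • ν := fun x => by fun_prop
  -- For fixed δ, letting k → ∞ removes the terms in f k - τ and f k - w; only the increment term,
  -- of order δ², remains.
  have hI : ∀ δ : ℝ, 0 < δ →
      ∫⁻ x, (∫⁻ t in Set.Ioc 0 δ, ‖τ x - w (x + t • ν)‖ₑ ^ 2) ∂μ ≤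
        4 * (ENNReal.ofReal δ ^ 2 * (C * M)) := by
    intro δ hδ
    have hk : ∀ k, ∫⁻ x, (∫⁻ t in Set.Ioc 0 δ, ‖τ x - w (x + t • ν)‖ₑ ^ 2) ∂μ ≤
        4 * ENNReal.ofReal δ * ∫⁻ x, ‖f k x - τ x‖ₑ ^ 2 ∂μ +
        4 * (ENNReal.ofReal δ ^ 2 * (C * M)) + 2 * C * ∫⁻ x, ‖f k x - w x‖ₑ ^ 2 ∂m := by
      intro k
      have hfm : Measurable (f k) := (hf k).continuous.measurable
      have m1 : Measurable fun x => ‖f k x - τ x‖ₑ ^ 2 := (hfm.sub hτ).enorm.pow_const 2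
      have m3 : Measurable fun x => ‖f k x - w x‖ₑ ^ 2 := (hfm.sub hw).enorm.pow_const 2
      have m2 : Measurable fun p : E × ℝ => ‖f k p.1 - f k (p.1 + p.2 • ν)‖ₑ ^ 2 :=
        ((hfm.comp measurable_fst).sub (hfm.comp hshift)).enorm.pow_const 2
      have m2' : Measurable fun x : E =>
          ∫⁻ t in Set.Ioc 0 δ, ‖f k x - f k (x + t • ν)‖ₑ ^ 2 := m2.lintegral_prod_right'
      calc _ ≤ ∫⁻ x, (4 * (ENNReal.ofReal δ * ‖f k x - τ x‖ₑ ^ 2) +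
            4 * (∫⁻ t in Set.Ioc 0 δ, ‖f k x - f k (x + t • ν)‖ₑ ^ 2) +
            2 * (∫⁻ t : ℝ, ‖f k (x + t • ν) - w (x + t • ν)‖ₑ ^ 2)) ∂μ := by
            refine lintegral_mono fun x => ?_
            calc _ ≤ ∫⁻ t in Set.Ioc 0 δ, (4 * ‖f k x - τ x‖ₑ ^ 2 +
                  4 * ‖f k x - f k (x + t • ν)‖ₑ ^ 2 +
                  2 * ‖f k (x + t • ν) - w (x + t • ν)‖ₑ ^ 2) :=
                  lintegral_mono fun t => enorm_sub_sq_le_three _ _ _ _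
              _ = (∫⁻ t in Set.Ioc 0 δ, 4 * ‖f k x - τ x‖ₑ ^ 2) +
                  (∫⁻ t in Set.Ioc 0 δ, 4 * ‖f k x - f k (x + t • ν)‖ₑ ^ 2) +
                  ∫⁻ t in Set.Ioc 0 δ, 2 * ‖f k (x + t • ν) - w (x + t • ν)‖ₑ ^ 2 := by
                  have m4 : Measurable fun t : ℝ => 2 * ‖f k (x + t • ν) - w (x + t • ν)‖ₑ ^ 2 :=
                    (m3.comp (hslice x)).const_mul 2
                  rw [lintegral_add_right _ m4, lintegral_add_left measurable_const]
              _ ≤ _ := by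
                rw [setLIntegral_const, Real.volume_Ioc, sub_zero,
                  lintegral_const_mul' _ _ (by finiteness),
                  lintegral_const_mul' _ _ (by finiteness)]
                gcongr ?_ + _ + _ * ?_
                · exact le_of_eq (by ring)
                · exact setLIntegral_le_lintegral _ _
        _ = 4 * (ENNReal.ofReal δ * ∫⁻ x, ‖f k x - τ x‖ₑ ^ 2 ∂μ) +
            4 * (∫⁻ x, (∫⁻ t in Set.Ioc 0 δ, ‖f k x - f k (x + t • ν)‖ₑ ^ 2) ∂μ) +
            2 * ∫⁻ x, (∫⁻ t : ℝ, ‖f k (x + t • ν) - w (x + t • ν)‖ₑ ^ 2) ∂μ := by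
            have m4 : Measurable fun x : E =>
                2 * (∫⁻ t : ℝ, ‖f k (x + t • ν) - w (x + t • ν)‖ₑ ^ 2) :=
              (m3.comp hshift).lintegral_prod_right'.const_mul 2
            rw [lintegral_add_right _ m4,
              lintegral_add_right _ (m2'.const_mul 4),
              lintegral_const_mul' _ _ (by finiteness), lintegral_const_mul' _ _ (by finiteness),
              lintegral_const_mul' _ _ (by finiteness), lintegral_const_mul' _ _ (by finiteness)]
        _ ≤ 4 * (ENNReal.ofReal δ * ∫⁻ x, ‖f k x - τ x‖ₑ ^ 2 ∂μ) +
            4 * (ENNReal.ofReal δ ^ 2 * (C * M)) +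
            2 * (C * ∫⁻ x, ‖f k x - w x‖ₑ ^ 2 ∂m) := by
            gcongr
            · refine (h.lintegral_sub_sq_le hν (hf k) δ).trans ?_
              gcongr
              exact hgrad k
            · exact h _ m3
        _ = _ := by ring
    have hlim : Tendsto (fun k => 4 * ENNReal.ofReal δ * ∫⁻ x, ‖f k x - τ x‖ₑ ^ 2 ∂μ +
        4 * (ENNReal.ofReal δ ^ 2 * (C * M)) + 2 * C * ∫⁻ x, ‖f k x - w x‖ₑ ^ 2 ∂m) atTop
        (𝓝 (4 * ENNReal.ofReal δ * 0 + 4 * (ENNReal.ofReal δ ^ 2 * (C * M)) + 2 * C * 0)) := by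
      refine Tendsto.add (Tendsto.add ?_ tendsto_const_nhds) ?_
      · exact ENNReal.Tendsto.const_mul hfτ (Or.inr (by finiteness))
      · exact ENNReal.Tendsto.const_mul hfw (Or.inr (by finiteness))
    have := ge_of_tendsto' hlim hk
    simpa using this
  -- `F j` averages over (0, 1/(j+1)]. By `hI` its μ-integral is O(1/(j+1)), while its lower limit
  -- dominates |τ - w|² wherever w is continuous; Fatou's lemma concludes.
  have hzero : ∫⁻ x, ‖τ x - w x‖ₑ ^ 2 ∂μ ≤ 0 := by
    let F : ℕ → E → ℝ≥0∞ := fun j x => ((j : ℝ≥0∞) + 1) *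
      ∫⁻ t in Set.Ioc (0 : ℝ) (1 / ((j : ℝ) + 1)), ‖τ x - w (x + t • ν)‖ₑ ^ 2
    have hF : ∀ j, Measurable (F j) := by
      intro j
      have m1 : Measurable fun p : E × ℝ => ‖τ p.1 - w (p.1 + p.2 • ν)‖ₑ ^ 2 :=
        ((hτ.comp measurable_fst).sub (hw.comp hshift)).enorm.pow_const 2
      exact m1.lintegral_prod_right'.const_mul _
    have hle : ∀ᵐ x ∂μ, ‖τ x - w x‖ₑ ^ 2 ≤ liminf (fun j => F j x) atTop := by
      filter_upwards [hcont] with x hx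
      have h1 : ContinuousAt (fun t : ℝ => w (x + t • ν)) 0 :=
        ContinuousAt.comp (g := w) (by simpa using hx) (by fun_prop)
      have h2 : ContinuousAt (fun t : ℝ => ‖τ x - w (x + t • ν)‖ₑ ^ 2) 0 :=
        (ENNReal.continuous_pow 2).continuousAt.comp
          (continuous_enorm.continuousAt.comp (continuousAt_const.sub h1))
      have h3 := le_liminf_average_of_continuousAt h2
      rwa [zero_smul, add_zero] at h3
    calc _ ≤ ∫⁻ x, liminf (fun j => F j x) atTop ∂μ := lintegral_mono_ae hle
      _ ≤ liminf (fun j => ∫⁻ x, F j x ∂μ) atTop := lintegral_liminf_le hF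
      _ ≤ liminf (fun j : ℕ => 4 * (C * M) * ENNReal.ofReal (1 / ((j : ℝ) + 1))) atTop := by
        refine liminf_le_liminf (Eventually.of_forall fun j => ?_)
        simp only [F]
        rw [lintegral_const_mul' _ _ (by finiteness)]
        refine (mul_le_mul_right (hI _ (by positivity)) _).trans (le_of_eq ?_)
        have e : ((j : ℝ≥0∞) + 1) * ENNReal.ofReal (1 / ((j : ℝ) + 1)) = 1 := by
          rw [one_div, ENNReal.ofReal_inv_of_pos (by positivity),
            ENNReal.ofReal_add (by positivity) zero_le_one, ENNReal.ofReal_natCast,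
            ENNReal.ofReal_one, ENNReal.mul_inv_cancel (by simp) (by finiteness)]
        calc _ = (((j : ℝ≥0∞) + 1) * ENNReal.ofReal (1 / ((j : ℝ) + 1))) *
              (4 * (C * M) * ENNReal.ofReal (1 / ((j : ℝ) + 1))) := by ring
          _ = _ := by rw [e, one_mul]
      _ = 0 := by
        refine Tendsto.liminf_eq ?_
        have h1 : Tendsto (fun j : ℕ => ENNReal.ofReal (1 / ((j : ℝ) + 1))) atTop (𝓝 0) := by
          simpa using ENNReal.tendsto_ofReal tendsto_one_div_add_atTop_nhds_zero_nat
        simpa using ENNReal.Tendsto.const_mul (a := 4 * (C * M)) h1 (Or.inr (by finiteness))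
  have hz : ∫⁻ x, ‖τ x - w x‖ₑ ^ 2 ∂μ = 0 := le_antisymm hzero bot_le
  have m1 : Measurable fun x => ‖τ x - w x‖ₑ ^ 2 := (hτ.sub hw).enorm.pow_const 2
  rw [lintegral_eq_zero_iff m1] at hz
  filter_upwards [hz] with x hx
  simpa [sub_eq_zero] using hx

end

end

/-! ### Lipschitz graphs and boundaries are transverse -/

section

variable {V : Type*} [NormedAddCommGroup V] [InnerProductSpace ℝ V]

/-- The parametrisation `y ↦ p + y + φ y ν` of the graph of `φ` over `νᗮ`. -/
def orthogonalGraph (p ν : V) (φ : (ℝ ∙ ν)ᗮ → ℝ) (y : (ℝ ∙ ν)ᗮ) : V :=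
  p + (y : V) + φ y • ν

theorem LipschitzWith.orthogonalGraph {K : NNReal} {ν : V} (hν : ‖ν‖ = 1) (p : V)
    {φ : (ℝ ∙ ν)ᗮ → ℝ} (hφ : LipschitzWith K φ) :
    LipschitzWith (1 + K) (orthogonalGraph p ν φ) := by
  have h1 : LipschitzWith 1 fun y : (ℝ ∙ ν)ᗮ => p + (y : V) :=
    LipschitzWith.of_dist_le_mul fun y z => by simp [Subtype.dist_eq]
  have h2 : LipschitzWith K fun y => φ y • ν :=
    LipschitzWith.of_dist_le_mul fun y z => by
      rw [dist_eq_norm, ← sub_smul, norm_smul, hν, mul_one, ← dist_eq_norm]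
      exact hφ.dist_le_mul y z
  exact h1.add h2

variable [FiniteDimensional ℝ V] [MeasurableSpace V] [BorelSpace V]

/-- Fubini's theorem in the orthogonal coordinates `x = p + y + t ν`. -/
theorem lintegral_orthogonal_add_smul {ν : V} (hν : ‖ν‖ = 1) (p : V) {g : V → ℝ≥0∞}
    (hg : Measurable g) :
    ∫⁻ y : (ℝ ∙ ν)ᗮ, (∫⁻ t : ℝ, g (p + (y : V) + t • ν)) = ∫⁻ x, g x := by
  have h := ((ℝ ∙ ν).measurePreserving_measurableEquivProd p).symm
  rw [InnerProductSpace.euclideanHausdorffMeasure_eq_volume] at h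
  -- Since ν is a unit vector, t ↦ tν is an isometry, so dt is the volume on the line.
  have hspan := (LinearIsometryEquiv.toSpanUnitSingleton (𝕜 := ℝ) ν hν).measurePreserving
  rw [← h.lintegral_comp hg, Measure.volume_eq_prod]
  refine Eq.trans ?_ (lintegral_prod_symm' _ (hg.comp h.measurable)).symm
  refine lintegral_congr fun y => ?_
  have hm : Measurable fun z : (ℝ ∙ ν) => g (((ℝ ∙ ν).measurableEquivProd p).symm (z, y)) :=
    hg.comp (h.measurable.comp measurable_prodMk_right)
  refine Eq.trans ?_ (hspan.lintegral_comp hm)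
  refine lintegral_congr fun t => congrArg g ?_
  simp only [Submodule.measurableEquivProd_symm_apply, LinearIsometryEquiv.toSpanUnitSingleton_apply,
    vadd_eq_add]
  abel

/-- A Lipschitz graph over the hyperplane `νᗮ` is transverse to `ν`. -/
theorem isTransverse_orthogonalGraph {K : NNReal} {ν : V} (hν : ‖ν‖ = 1) (p : V)
    {φ : (ℝ ∙ ν)ᗮ → ℝ} (hφ : LipschitzWith K φ) :
    IsTransverse volume
      ((Measure.euclideanHausdorffMeasure (Module.finrank ℝ (ℝ ∙ ν)ᗮ)).restrict
        (Set.range (orthogonalGraph p ν φ)))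
      ν (((1 + K) ^ Module.finrank ℝ (ℝ ∙ ν)ᗮ : NNReal) : ℝ≥0∞) := by
  set d := Module.finrank ℝ (ℝ ∙ ν)ᗮ with hd
  have hlip := hφ.orthogonalGraph hν p
  have hmeas : Measurable (orthogonalGraph p ν φ) := hlip.continuous.measurable
  -- A (1 + K)-Lipschitz map enlarges d-dimensional Hausdorff measure by at most (1 + K)^d, and on
  -- νᗮ the normalised measure is Lebesgue measure.
  have hle : (Measure.euclideanHausdorffMeasure d).restrict (Set.range (orthogonalGraph p ν φ)) ≤
      (((1 + K) ^ d : NNReal) : ℝ≥0∞) • (volume : Measure (ℝ ∙ ν)ᗮ).map (orthogonalGraph p ν φ) := by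
    refine Measure.le_iff.mpr fun s hs => ?_
    rw [Measure.restrict_apply hs, Measure.smul_apply, Measure.map_apply hmeas hs,
      ← Set.image_preimage_eq_inter_range,
      ← InnerProductSpace.euclideanHausdorffMeasure_eq_volume (V := (ℝ ∙ ν)ᗮ), ← hd]
    simp only [Measure.euclideanHausdorffMeasure_def, Measure.smul_apply]
    have h1 := hlip.hausdorffMeasure_image_le (d := d) (Nat.cast_nonneg d)
      (orthogonalGraph p ν φ ⁻¹' s)
    rw [ENNReal.rpow_natCast] at h1
    simp only [ENNReal.smul_def, smul_eq_mul]
    rw [mul_left_comm]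
    push_cast at h1 ⊢
    exact mul_le_mul_right h1 _
  intro g hg
  have hsh : Measurable fun q : V × ℝ => q.1 + q.2 • ν := by fun_prop
  have hgm : Measurable fun x => ∫⁻ t : ℝ, g (x + t • ν) := (hg.comp hsh).lintegral_prod_right'
  calc _ ≤ _ := lintegral_mono' hle le_rfl
    _ = (((1 + K) ^ d : NNReal) : ℝ≥0∞) *
        ∫⁻ y, (∫⁻ t : ℝ, g (orthogonalGraph p ν φ y + t • ν)) := by
      rw [lintegral_smul_measure, lintegral_map hgm hmeas, smul_eq_mul]
    _ = _ := by
      congr 1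
      rw [← lintegral_orthogonal_add_smul hν p hg]
      refine lintegral_congr fun y => ?_
      -- Translation invariance in t absorbs the height φ y, so the graph sweeps out ℝⁿ exactly as
      -- the hyperplane does.
      rw [← lintegral_add_left_eq_self (fun t : ℝ => g (p + (y : V) + t • ν)) (φ y)]
      refine lintegral_congr fun t => congrArg g ?_
      rw [orthogonalGraph, add_assoc, add_smul]

end

theorem finrank_orthogonal_of_norm_eq_one {n : ℕ} {ν : EuclideanSpace ℝ (Fin n)} (hν : ‖ν‖ = 1) :
    Module.finrank ℝ (ℝ ∙ ν)ᗮ = n - 1 := by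
  have h1 := (ℝ ∙ ν).finrank_add_finrank_orthogonal
  have h0 : ν ≠ 0 := by rintro rfl; simp at hν
  rw [finrank_span_singleton h0, finrank_euclideanSpace_fin] at h1
  omega

/-- Near each of its points, a Lipschitz boundary is transverse to some direction. -/
theorem HasLipschitzBoundary.exists_isTransverse {n : ℕ} {U : Set (EuclideanSpace ℝ (Fin n))}
    (hU : HasLipschitzBoundary U) {p : EuclideanSpace ℝ (Fin n)} (hp : p ∈ frontier U) :
    ∃ W ∈ 𝓝 p, ∃ (ν : EuclideanSpace ℝ (Fin n)) (C : NNReal), ‖ν‖ = 1 ∧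
      IsTransverse volume (surfaceMeasure (frontier U ∩ W)) ν C := by
  obtain ⟨ν, hν, r, h, K, φ, hr, hh, hφ, hgraph⟩ := hU p hp
  let P := (ℝ ∙ ν)ᗮ.orthogonalProjectionOnto
  let W : Set (EuclideanSpace ℝ (Fin n)) := {x | ‖P (x - p)‖ < r ∧ |inner ℝ ν (x - p)| < h}
  have hWo : IsOpen W := by
    have h1 : Continuous fun x => ‖P (x - p)‖ := by fun_prop
    have h2 : Continuous fun x => |(inner ℝ ν (x - p) : ℝ)| := by fun_prop
    exact (isOpen_lt h1 continuous_const).inter (isOpen_lt h2 continuous_const)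
  refine ⟨W, hWo.mem_nhds (by simp [W, hr, hh]), ν, _, hν,
    (isTransverse_orthogonalGraph hν p hφ).mono ?_⟩
  rw [surfaceMeasure, finrank_orthogonal_of_norm_eq_one hν]
  refine Measure.restrict_mono ?_ le_rfl
  rintro x ⟨hxU, hxr, hxh⟩
  have hx : p + (P (x - p) : EuclideanSpace ℝ (Fin n)) + (inner ℝ ν (x - p) : ℝ) • ν = x := by
    have h1 := (ℝ ∙ ν).starProjection_add_starProjection_orthogonal (x - p)
    rw [Submodule.starProjection_unit_singleton ℝ hν] at h1
    have h2 : (P (x - p) : EuclideanSpace ℝ (Fin n)) = (ℝ ∙ ν)ᗮ.starProjection (x - p) := rfl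
    rw [add_assoc, h2, add_comm (Submodule.starProjection _ _), h1]
    abel
  refine ⟨P (x - p), ?_⟩
  have h3 := ((hgraph _ hxr).2 _ hxh).2
  rw [hx] at h3
  rw [orthogonalGraph, ← h3.mp hxU, hx]

/-- A subset of a bounded Lipschitz boundary consists of finitely many pieces, each of them
transverse to some direction. -/
theorem HasLipschitzBoundary.exists_finite_isTransverse {n : ℕ}
    {U Γ : Set (EuclideanSpace ℝ (Fin n))} (hU : HasLipschitzBoundary U)
    (hb : Bornology.IsBounded U) (hΓ : Γ ⊆ frontier U) :
    ∃ (s : Finset (EuclideanSpace ℝ (Fin n)))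
      (μ : s → Measure (EuclideanSpace ℝ (Fin n))) (ν : s → EuclideanSpace ℝ (Fin n))
      (C : s → NNReal), (∀ i, ‖ν i‖ = 1) ∧ (∀ i, IsTransverse volume (μ i) (ν i) (C i)) ∧
      (∀ i, μ i ≤ surfaceMeasure Γ) ∧ surfaceMeasure Γ ≤ Measure.sum μ := by
  have hc : IsCompact (frontier U) :=
    Metric.isCompact_of_isClosed_isBounded isClosed_frontier
      (hb.closure.subset frontier_subset_closure)
  choose! W hW ν C hν htr using fun p hp => hU.exists_isTransverse (p := p) hp
  obtain ⟨s, hs, hcover⟩ := hc.elim_nhds_subcover W hW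
  refine ⟨s, fun i => surfaceMeasure (Γ ∩ W i), fun i => ν i, fun i => C i,
    fun i => hν _ (hs _ i.2), fun i => (htr _ (hs _ i.2)).mono ?_, fun i => ?_, ?_⟩
  · exact Measure.restrict_mono (Set.inter_subset_inter_left _ hΓ) le_rfl
  · exact Measure.restrict_mono Set.inter_subset_left le_rfl
  -- Overlapping pieces are harmless: only subadditivity is needed, and it holds without
  -- measurability of Γ.
  · refine le_trans (Measure.restrict_mono (s' := ⋃ i : s, Γ ∩ W i) (fun x hx => ?_) le_rfl)
      Measure.restrict_iUnion_le
    obtain ⟨i, hi, hxi⟩ := Set.mem_iUnion₂.mp (hcover (hΓ hx))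
    exact Set.mem_iUnion.mpr ⟨⟨i, hi⟩, hx, hxi⟩

/-! ### L² norms as integrals of squares -/

theorem MeasureTheory.eLpNorm_two_sq {α F : Type*} [MeasurableSpace α] {μ : Measure α}
    [NormedAddCommGroup F] (f : α → F) : eLpNorm f 2 μ ^ 2 = ∫⁻ x, ‖f x‖ₑ ^ 2 ∂μ := by
  have h := eLpNorm_nnreal_pow_eq_lintegral (f := f) (μ := μ) (p := 2) two_ne_zero
  rw [NNReal.coe_two] at h
  exact_mod_cast h

/-- The squared norm in `L²(S)` of the restriction of a function that vanishes outside `S`. -/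
theorem lintegral_sq_eq_enorm_Lp_sq {α F G : Type*} [MeasurableSpace α] {m : Measure α}
    [NormedAddCommGroup F] [NormedAddCommGroup G] {S : Set α} (hS : MeasurableSet S)
    (u : Lp F 2 (m.restrict S)) {f : α → G} (hf : ∀ᵐ x ∂m.restrict S, ‖f x‖ₑ = ‖u x‖ₑ)
    (h0 : ∀ x ∉ S, f x = 0) : ∫⁻ x, ‖f x‖ₑ ^ 2 ∂m = ‖u‖ₑ ^ 2 := by
  have h1 : ∫⁻ x, ‖f x‖ₑ ^ 2 ∂m = ∫⁻ x in S, ‖f x‖ₑ ^ 2 ∂m := by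
    rw [← lintegral_indicator hS]
    refine lintegral_congr fun x => ?_
    by_cases hx : x ∈ S
    · rw [Set.indicator_of_mem hx]
    · rw [Set.indicator_of_notMem hx, h0 x hx]
      simp
  rw [h1, Lp.enorm_def, eLpNorm_two_sq]
  refine lintegral_congr_ae ?_
  filter_upwards [hf] with x hx
  rw [hx]

theorem WithLp.prod_enorm_sq_eq {α β : Type*} [SeminormedAddCommGroup α]
    [SeminormedAddCommGroup β] (x : WithLp 2 (α × β)) :
    ‖x‖ₑ ^ 2 = ‖x.fst‖ₑ ^ 2 + ‖x.snd‖ₑ ^ 2 := by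
  simp only [enorm_eq_nnnorm]
  norm_cast
  exact NNReal.eq (by push_cast; exact WithLp.prod_norm_sq_eq_of_L2 x)

theorem tendsto_enorm_sub_sq_zero {α G : Type*} [SeminormedAddCommGroup G] {l : Filter α}
    {u : α → G} {a : G} (h : Tendsto u l (𝓝 a)) : Tendsto (fun k => ‖u k - a‖ₑ ^ 2) l (𝓝 0) := by
  have h1 := ((ENNReal.continuous_pow 2).tendsto 0).comp (tendsto_iff_edist_tendsto_0.mp h)
  simpa [Function.comp_def, edist_eq_enorm_sub] using h1

/-! ### Trace of test functions and its extension to H₀¹ -/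

section

variable {n : ℕ} {Ω : Opens (EuclideanSpace ℝ (Fin n))}

theorem TestFunction.eq_zero_of_notMem (φ : 𝓓(Ω, ℝ)) {x : EuclideanSpace ℝ (Fin n)}
    (hx : x ∉ (Ω : Set (EuclideanSpace ℝ (Fin n)))) : φ x = 0 :=
  image_eq_zero_of_notMem_tsupport fun h => hx (φ.tsupport_subset h)

theorem TestFunction.fderiv_eq_zero_of_notMem (φ : 𝓓(Ω, ℝ)) {x : EuclideanSpace ℝ (Fin n)}
    (hx : x ∉ (Ω : Set (EuclideanSpace ℝ (Fin n)))) : fderiv ℝ φ x = 0 :=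
  fderiv_of_notMem_tsupport ℝ fun h => hx (φ.tsupport_subset h)

/-- The test function `φ` represents the element `y` of `H¹(Ω)`. -/
def IsTestRepr (φ : 𝓓(Ω, ℝ)) (y : H1 Ω) : Prop :=
  (y.1.fst : EuclideanSpace ℝ (Fin n) → ℝ)
      =ᵐ[volume.restrict (Ω : Set (EuclideanSpace ℝ (Fin n)))] φ ∧
    (y.1.snd : EuclideanSpace ℝ (Fin n) → EuclideanSpace ℝ (Fin n))
      =ᵐ[volume.restrict (Ω : Set (EuclideanSpace ℝ (Fin n)))] gradient φ

/-- Transversality needs integrals over all of ℝⁿ; the support of φ lies in Ω, so extension by zero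
adds nothing. -/
theorem IsTestRepr.lintegral_fderiv_sq {φ : 𝓓(Ω, ℝ)} {y : H1 Ω} (h : IsTestRepr φ y) :
    ∫⁻ x, ‖fderiv ℝ φ x‖ₑ ^ 2 = ‖y.1.snd‖ₑ ^ 2 := by
  refine lintegral_sq_eq_enorm_Lp_sq Ω.isOpen.measurableSet _ ?_
    fun x hx => φ.fderiv_eq_zero_of_notMem hx
  filter_upwards [h.2] with x hx
  rw [hx, gradient, LinearIsometryEquiv.enorm_map]

theorem IsTestRepr.lintegral_sq {φ : 𝓓(Ω, ℝ)} {y : H1 Ω} (h : IsTestRepr φ y) :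
    ∫⁻ x, ‖φ x‖ₑ ^ 2 = ‖y.1.fst‖ₑ ^ 2 := by
  refine lintegral_sq_eq_enorm_Lp_sq Ω.isOpen.measurableSet _ ?_
    fun x hx => φ.eq_zero_of_notMem hx
  filter_upwards [h.1] with x hx
  rw [hx]

/-- Lebesgue measure charges every nonempty open set. Equality everywhere in Ω is what makes the
restriction to a surface independent of the representative. -/
theorem IsTestRepr.eqOn {φ : 𝓓(Ω, ℝ)} {y : H1 Ω} {f : EuclideanSpace ℝ (Fin n) → ℝ}
    (h : IsTestRepr φ y) (hf : Continuous f)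
    (h' : (y.1.fst : EuclideanSpace ℝ (Fin n) → ℝ)
      =ᵐ[volume.restrict (Ω : Set (EuclideanSpace ℝ (Fin n)))] f) :
    Set.EqOn φ f (Ω : Set (EuclideanSpace ℝ (Fin n))) :=
  Measure.eqOn_open_of_ae_eq (h.1.symm.trans h') Ω.isOpen φ.continuous.continuousOn
    hf.continuousOn

/-- A trace inequality for test functions yields a bounded linear trace on `testSubspace Ω`. -/
theorem exists_trace_testSubspace {μ : Measure (EuclideanSpace ℝ (Fin n))} {K : NNReal}
    (hμ : ∀ᵐ x ∂μ, x ∈ (Ω : Set (EuclideanSpace ℝ (Fin n))))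
    (hK : ∀ φ : 𝓓(Ω, ℝ), ∫⁻ x, ‖φ x‖ₑ ^ 2 ∂μ ≤
      K * ((∫⁻ x, ‖φ x‖ₑ ^ 2) + ∫⁻ x, ‖fderiv ℝ φ x‖ₑ ^ 2)) :
    ∃ T : testSubspace Ω →ₗ[ℝ] Lp ℝ 2 μ,
      (∀ (y : testSubspace Ω) (φ : 𝓓(Ω, ℝ)), IsTestRepr φ y.1 → T y =ᵐ[μ] φ) ∧
      ∀ y, ‖T y‖ ≤ √K * ‖y‖ := by
  have hbound : ∀ (y : testSubspace Ω) (φ : 𝓓(Ω, ℝ)), IsTestRepr φ y.1 →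
      eLpNorm φ 2 μ ^ 2 ≤ K * ‖y‖ₑ ^ 2 := by
    intro y φ h
    have h1 : ‖y‖ₑ ^ 2 = ‖y.1.1.fst‖ₑ ^ 2 + ‖y.1.1.snd‖ₑ ^ 2 :=
      WithLp.prod_enorm_sq_eq y.1.1
    rw [eLpNorm_two_sq, h1, ← h.lintegral_sq, ← h.lintegral_fderiv_sq]
    exact hK φ
  have hex : ∀ y : testSubspace Ω, ∃ φ : 𝓓(Ω, ℝ), IsTestRepr φ y.1 := fun y => y.2
  choose Φ hΦ using hex
  have hmem : ∀ y, MemLp (Φ y) 2 μ := fun y => by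
    refine ⟨(Φ y).continuous.aestronglyMeasurable, ?_⟩
    have h1 : eLpNorm (Φ y) 2 μ ^ 2 < ∞ := (hbound y _ (hΦ y)).trans_lt (by finiteness)
    exact (ENNReal.pow_lt_top_iff.mp h1).resolve_right two_ne_zero
  -- The choice `Φ` need not be linear; this uniqueness gives linearity up to μ-null sets.
  have huniq : ∀ (y : testSubspace Ω) (f : EuclideanSpace ℝ (Fin n) → ℝ), Continuous f →
      (y.1.1.fst : EuclideanSpace ℝ (Fin n) → ℝ)
        =ᵐ[volume.restrict (Ω : Set (EuclideanSpace ℝ (Fin n)))] f → Φ y =ᵐ[μ] f := by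
    intro y f hf h
    have h1 := (hΦ y).eqOn hf h
    filter_upwards [hμ] with x hx using h1 hx
  have hadd : ∀ a b, Φ (a + b) =ᵐ[μ] ⇑(Φ a) + ⇑(Φ b) := fun a b => by
    refine huniq _ _ ((Φ a).continuous.add (Φ b).continuous) ?_
    have e : (a + b).1.1.fst = a.1.1.fst + b.1.1.fst := rfl
    rw [e]
    filter_upwards [Lp.coeFn_add a.1.1.fst b.1.1.fst, (hΦ a).1, (hΦ b).1] with x hx h1 h2
    rw [hx, Pi.add_apply, Pi.add_apply, h1, h2]
  have hsmul : ∀ (c : ℝ) a, Φ (c • a) =ᵐ[μ] c • ⇑(Φ a) := fun c a => by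
    refine huniq _ _ ((Φ a).continuous.const_smul c) ?_
    have e : (c • a).1.1.fst = c • a.1.1.fst := rfl
    rw [e]
    filter_upwards [Lp.coeFn_smul c a.1.1.fst, (hΦ a).1] with x hx h1
    rw [hx, Pi.smul_apply, Pi.smul_apply, h1]
  let T : testSubspace Ω →ₗ[ℝ] Lp ℝ 2 μ :=
    { toFun := fun y => (hmem y).toLp (Φ y)
      map_add' := fun a b =>
        (MemLp.toLp_congr _ ((hmem a).add (hmem b)) (hadd a b)).trans (MemLp.toLp_add _ _)
      map_smul' := fun c a =>
        (MemLp.toLp_congr _ ((hmem a).const_smul c) (hsmul c a)).trans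
          (MemLp.toLp_const_smul _ _) }
  refine ⟨T, fun y φ h => ?_, fun y => ?_⟩
  · exact (hmem y).coeFn_toLp.trans (huniq y φ φ.continuous h.1)
  · have h1 : ‖(hmem y).toLp (Φ y)‖ₑ ^ 2 ≤ K * ‖y‖ₑ ^ 2 := by
      rw [Lp.enorm_toLp]
      exact hbound y _ (hΦ y)
    have h2 : ‖(hmem y).toLp (Φ y)‖ ^ 2 ≤ K * ‖y‖ ^ 2 := by
      simp only [enorm_eq_nnnorm] at h1
      exact_mod_cast h1
    refine abs_le_of_sq_le_sq' ?_ (by positivity) |>.2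
    rw [mul_pow, Real.sq_sqrt K.coe_nonneg]
    exact h2

/-- The inclusion of `C_c^∞(Ω)` into `H_0^1(Ω)`. -/
noncomputable def testInclusion (Ω : Opens (EuclideanSpace ℝ (Fin n))) :
    testSubspace Ω →ₗ[ℝ] H01 Ω :=
  Submodule.inclusion (testSubspace Ω).le_topologicalClosure

theorem denseRange_testInclusion : DenseRange (testInclusion Ω) :=
  (denseRange_inclusion_iff (testSubspace Ω).le_topologicalClosure).mpr subset_rfl

/-- A continuous extension to `H_0^1(Ω)` of the restriction of test functions agrees on the
continuous elements of `H_0^1(Ω)` with the restriction, on a transverse measure. -/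
theorem trace_ae_eq_of_isTransverse {μ μ' : Measure (EuclideanSpace ℝ (Fin n))}
    (hμ : ∀ᵐ x ∂μ, x ∈ (Ω : Set (EuclideanSpace ℝ (Fin n)))) (hle : μ' ≤ μ)
    {ν : EuclideanSpace ℝ (Fin n)} {C : NNReal} (hν : ‖ν‖ = 1)
    (htr : IsTransverse volume μ' ν C) {T : H01 Ω →L[ℝ] Lp ℝ 2 μ}
    (hT : ∀ (z : testSubspace Ω) (φ : 𝓓(Ω, ℝ)), IsTestRepr φ z.1 →
      T (testInclusion Ω z) =ᵐ[μ] φ)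
    {y : H01 Ω} {v : EuclideanSpace ℝ (Fin n) → ℝ}
    (hv : ContinuousOn v (Ω : Set (EuclideanSpace ℝ (Fin n))))
    (hyv : (H01.toL2 y : EuclideanSpace ℝ (Fin n) → ℝ)
      =ᵐ[volume.restrict (Ω : Set (EuclideanSpace ℝ (Fin n)))] v) :
    T y =ᵐ[μ'] v := by
  obtain ⟨z, hz⟩ : ∃ z : ℕ → testSubspace Ω, Tendsto (fun k => testInclusion Ω (z k)) atTop (𝓝 y) := by
    obtain ⟨u, hu, hlim⟩ := mem_closure_iff_seq_limit.mp (denseRange_testInclusion y)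
    choose z hz using hu
    exact ⟨z, by simpa only [hz] using hlim⟩
  have hex : ∀ k, ∃ φ : 𝓓(Ω, ℝ), IsTestRepr φ (z k).1 := fun k => (z k).2
  choose Φ hΦ using hex
  -- Extension by zero makes v measurable on ℝⁿ and may create jumps only outside the open set Ω,
  -- which μ does not see.
  set w := (Ω : Set (EuclideanSpace ℝ (Fin n))).indicator v with hw
  have hwm : Measurable w := by
    classical
    rw [hw, ← Set.piecewise_eq_indicator]
    exact hv.measurable_piecewise continuousOn_const Ω.isOpen.measurableSet
  have hτm : Measurable (T y : EuclideanSpace ℝ (Fin n) → ℝ) :=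
    (Lp.stronglyMeasurable _).measurable
  have hsub := tendsto_enorm_sub_sq_zero hz
  have hsub_eq : ∀ k, ‖testInclusion Ω (z k) - y‖ₑ ^ 2 =
      ‖(z k).1.1.fst - y.1.1.fst‖ₑ ^ 2 + ‖(z k).1.1.snd - y.1.1.snd‖ₑ ^ 2 := fun k =>
    WithLp.prod_enorm_sq_eq (testInclusion Ω (z k) - y).1.1
  obtain ⟨M, hM⟩ : ∃ M : NNReal, ∀ k, ‖testInclusion Ω (z k)‖₊ ≤ M := by
    obtain ⟨R, hR⟩ := (Metric.isBounded_range_of_tendsto _ hz).exists_norm_le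
    exact ⟨R.toNNReal, fun k => by
      rw [← NNReal.coe_le_coe, coe_nnnorm]
      exact (hR _ ⟨k, rfl⟩).trans (Real.le_coe_toNNReal R)⟩
  have hgrad : ∀ k, ∫⁻ x, ‖fderiv ℝ (Φ k) x‖ₑ ^ 2 ≤ (M : ℝ≥0∞) ^ 2 := by
    intro k
    rw [(hΦ k).lintegral_fderiv_sq]
    have h1 : ‖testInclusion Ω (z k)‖ₑ ^ 2 = ‖(z k).1.1.fst‖ₑ ^ 2 + ‖(z k).1.1.snd‖ₑ ^ 2 :=
      WithLp.prod_enorm_sq_eq (testInclusion Ω (z k)).1.1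
    refine le_add_self.trans (h1.symm.le.trans (pow_le_pow_left' ?_ 2))
    exact ENNReal.coe_le_coe.mpr (hM k)
  have hfw : Tendsto (fun k => ∫⁻ x, ‖Φ k x - w x‖ₑ ^ 2) atTop (𝓝 0) := by
    refine tendsto_of_tendsto_of_tendsto_of_le_of_le tendsto_const_nhds hsub
      (fun k => zero_le) fun k => ?_
    have h1 : ∫⁻ x, ‖Φ k x - w x‖ₑ ^ 2 = ‖(z k).1.1.fst - y.1.1.fst‖ₑ ^ 2 := by
      refine lintegral_sq_eq_enorm_Lp_sq Ω.isOpen.measurableSet _ ?_ fun x hx => ?_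
      · filter_upwards [Lp.coeFn_sub (z k).1.1.fst y.1.1.fst, (hΦ k).1, hyv,
          ae_restrict_mem Ω.isOpen.measurableSet] with x h1 h2 h3 h4
        rw [h1, Pi.sub_apply, h2, hw, Set.indicator_of_mem h4, ← h3]
        rfl
      · rw [(Φ k).eq_zero_of_notMem hx, hw, Set.indicator_of_notMem hx, sub_zero]
    simp only [h1, hsub_eq]
    exact le_self_add
  have hfτ : Tendsto (fun k => ∫⁻ x, ‖Φ k x - T y x‖ₑ ^ 2 ∂μ) atTop (𝓝 0) := by
    refine (tendsto_enorm_sub_sq_zero ((T.continuous.tendsto y).comp hz)).congr fun k => ?_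
    rw [Function.comp_apply, Lp.enorm_def, eLpNorm_two_sq]
    refine lintegral_congr_ae ?_
    filter_upwards [Lp.coeFn_sub (T (testInclusion Ω (z k))) (T y), hT _ _ (hΦ k)] with x hx h2
    rw [hx, Pi.sub_apply, h2]
  have hcont : ∀ᵐ x ∂μ, ContinuousAt w x := by
    filter_upwards [hμ] with x hx
    have h1 : w =ᶠ[𝓝 x] v := by
      filter_upwards [Ω.isOpen.mem_nhds hx] with a ha using Set.indicator_of_mem ha v
    exact (hv.continuousAt (Ω.isOpen.mem_nhds hx)).congr h1.symm
  have hpiece : T y =ᵐ[μ'] w :=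
    htr.ae_eq_of_tendsto hν coe_ne_top (fun k => (Φ k).contDiff.of_le (by simp)) hwm hτm
      (by finiteness) hgrad hfw
      -- Convergence in L²(μ) passes to the piece because μ' ≤ μ.
      (tendsto_of_tendsto_of_tendsto_of_le_of_le tendsto_const_nhds hfτ (fun k => zero_le)
        fun k => lintegral_mono' hle le_rfl)
      (ae_mono hle hcont)
  filter_upwards [hpiece, ae_mono hle hμ] with x h1 h2
  rw [h1, hw, Set.indicator_of_mem h2]

/-- If `μ` consists of finitely many transverse pieces in `Ω`, there is a trace operator from
`H_0^1(Ω)` to `L²(μ)`. -/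
theorem exists_trace_of_isTransverse {μ : Measure (EuclideanSpace ℝ (Fin n))}
    (hμ : ∀ᵐ x ∂μ, x ∈ (Ω : Set (EuclideanSpace ℝ (Fin n)))) {ι : Type*} [Finite ι]
    {μ' : ι → Measure (EuclideanSpace ℝ (Fin n))} {ν : ι → EuclideanSpace ℝ (Fin n)}
    {C : ι → NNReal} (hν : ∀ i, ‖ν i‖ = 1) (htr : ∀ i, IsTransverse volume (μ' i) (ν i) (C i))
    (hle : ∀ i, μ' i ≤ μ) (hsum : μ ≤ Measure.sum μ') :
    ∃ T : H01 Ω →L[ℝ] Lp ℝ 2 μ,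
      (∀ (y : H01 Ω) (v : EuclideanSpace ℝ (Fin n) → ℝ),
        ContinuousOn v (Ω : Set (EuclideanSpace ℝ (Fin n))) →
        (H01.toL2 y : EuclideanSpace ℝ (Fin n) → ℝ)
          =ᵐ[volume.restrict (Ω : Set (EuclideanSpace ℝ (Fin n)))] v →
        (T y : EuclideanSpace ℝ (Fin n) → ℝ) =ᵐ[μ] v) ∧
      ∃ C : ℝ, 0 < C ∧ ∀ y : H01 Ω, ‖T y‖ ≤ C * ‖y‖ := by
  have := Fintype.ofFinite ι
  have hC1 : ∀ φ : 𝓓(Ω, ℝ), ContDiff ℝ 1 φ := fun φ => φ.contDiff.of_le (by simp)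
  obtain ⟨T₀, hT₀, hbd⟩ := exists_trace_testSubspace (Ω := Ω) (K := ∑ i, 2 * C i) hμ fun φ => by
    calc _ ≤ ∫⁻ x, ‖φ x‖ₑ ^ 2 ∂Measure.sum μ' := lintegral_mono' hsum le_rfl
      _ = ∑ i, ∫⁻ x, ‖φ x‖ₑ ^ 2 ∂μ' i := by rw [lintegral_sum_measure, tsum_fintype]
      _ ≤ ∑ i, 2 * (C i : ℝ≥0∞) * ((∫⁻ x, ‖φ x‖ₑ ^ 2) + ∫⁻ x, ‖fderiv ℝ φ x‖ₑ ^ 2) :=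
        Finset.sum_le_sum fun i _ => (htr i).lintegral_sq_le (hν i) (hC1 φ)
      _ = _ := by rw [← Finset.sum_mul]; push_cast; rfl
  have hTe : ∀ z, T₀.extendOfNorm (testInclusion Ω) (testInclusion Ω z) = T₀ z :=
    LinearMap.extendOfNorm_eq denseRange_testInclusion ⟨_, hbd⟩
  have hnorm : ∀ y, ‖T₀.extendOfNorm (testInclusion Ω) y‖ ≤
      √(∑ i, 2 * C i : NNReal) * ‖y‖ :=
    LinearMap.norm_extendOfNorm_apply_le denseRange_testInclusion _ hbd
  generalize T₀.extendOfNorm (testInclusion Ω) = T at hTe hnorm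
  -- The summand 1 keeps the constant positive even if the sum vanishes, for instance when there are
  -- no pieces.
  refine ⟨T, fun y v hv hyv => ?_, √(∑ i, 2 * C i : NNReal) + 1, by positivity,
    fun y => (hnorm y).trans ?_⟩
  · refine ae_mono hsum (Measure.ae_sum_iff.mpr fun i => ?_)
    refine trace_ae_eq_of_isTransverse hμ (hle i) (hν i) (htr i) (fun z φ h => ?_) hv hyv
    rw [hTe]
    exact hT₀ z φ h
  · gcongr
    exact le_add_of_nonneg_right zero_le_one

end

theorem lemma2p2 (n : ℕ) (hn : n = 2 ∨ n = 3)
    (Ω : Opens (EuclideanSpace ℝ (Fin n)))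
    (hΩ : Bornology.IsBounded (Ω : Set (EuclideanSpace ℝ (Fin n))))
    (Γ : Set (EuclideanSpace ℝ (Fin n))) (hΓ : IsC2Hypersurface Γ)
    (hΓΩ : Γ ⊆ (Ω : Set (EuclideanSpace ℝ (Fin n))))
    (hU : ∃ U : Set (EuclideanSpace ℝ (Fin n)), IsOpen U ∧
      U ⊆ (Ω : Set (EuclideanSpace ℝ (Fin n))) ∧ HasLipschitzBoundary U ∧ Γ ⊆ frontier U) :
    ∃ T : H01 Ω →L[ℝ] L2Surf Γ,
      (∀ (y : H01 Ω) (v : EuclideanSpace ℝ (Fin n) → ℝ),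
        ContinuousOn v (Ω : Set (EuclideanSpace ℝ (Fin n))) →
        (H01.toL2 y : EuclideanSpace ℝ (Fin n) → ℝ)
          =ᵐ[volume.restrict (Ω : Set (EuclideanSpace ℝ (Fin n)))] v →
        (T y : EuclideanSpace ℝ (Fin n) → ℝ) =ᵐ[surfaceMeasure Γ] v) ∧
      ∃ C : ℝ, 0 < C ∧ ∀ y : H01 Ω, ‖T y‖ ≤ C * ‖y‖ := by
  obtain ⟨U, -, hUΩ, hlip, hΓU⟩ := hU
  obtain ⟨s, μ, ν, C, hν, htr, hle, hsum⟩ :=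
    hlip.exists_finite_isTransverse (hΩ.subset hUΩ) hΓU
  -- Comparison with the restriction to the open set Ω avoids any measurability of Γ.
  have hmem : ∀ᵐ x ∂surfaceMeasure Γ, x ∈ (Ω : Set (EuclideanSpace ℝ (Fin n))) :=
    ae_mono (Measure.restrict_mono hΓΩ le_rfl)
      (ae_restrict_mem Ω.isOpen.measurableSet)
  exact exists_trace_of_isTransverse hmem hν htr hle hsum
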